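/- Let $\mathcal Z$ be a measurable space, let $Z_1,\dots,Z_{T+1}$ be $\mathcal Z$-valued random variables (no stationarity or mixing is assumed), and for each $t\le T+1$ let $\mathbf p_t(\cdot\mid z_1,\dots,z_{t-1})$ be a regular conditional distribution of $Z_t$ given $Z_1,\dots,Z_{t-1}$; conditional expectations given the past are computed with these. Let $\mathcal F$ be a non-empty family of measurable functions $f\colon\mathcal Z\to[0,M]$ (the bounded losses of the hypotheses) such that for every $a\in\mathbb R^T$ the map $(z_1,\dots,z_T)\mapsto\sup_{f\in\mathcal F}\sum_{t=1}^T a_tf(z_t)$ is measurable up to null sets of every probability measure on $\mathcal Z^T$. Let $\mathbf q=(q_1,\dots,q_T)\in\mathbb R^T$ be an arbitrary weight vector and put $$\Phi(\mathbf Z_1^T)=\sup_{f\in\mathcal F}\Big(\mathbb E[f(Z_{T+1})\mid \mathbf Z_1^T]-\sum_{t=1}^T q_tf(Z_t)\Big),$$ $$\mathrm{disc}(\mathbf q)=\sup_{f\in\mathcal F}\Big(\mathbb E[f(Z_{T+1})\mid \mathbf Z_1^T]-\sum_{t=1}^T q_t\,\mathbb E[f(Z_t)\mid \mathbf Z_1^{t-1}]\Big).$$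 A tree $\mathbf z$ of depth $T$ is a sequence of maps $z_t\colon\{\pm1\}^{t-1}\to\mathcal Z$, $1\le t\le T$; write $z_t(\sigma)=z_t(\sigma_1,\dots,\sigma_{t-1})$. A set $V$ of real-valued trees of depth $T$ is a sequential $\alpha$-cover of $\mathcal F$ on $\mathbf z$ if for all $f\in\mathcal F$ and $\sigma\in\{\pm1\}^T$ there is $\mathbf v\in V$ with $\|\mathbf q\|_\infty\sum_{t=1}^T|v_t(\sigma)-f(z_t(\sigma))|\le\alpha$, and $\mathcal N_1(\alpha,\mathcal F,\mathbf z)\in\mathbb N\cup\{\infty\}$ is the least size of such a cover. The distribution $T(\mathbf p)$ is that of the tree of the $Z_t$'s obtained by drawing a tree of pairs level by level: at the node reached by $(\sigma_1,\dots,\sigma_{t-1})$ two independent points $Z_t,Z_t'$ are drawn from $\mathbf p_t(\cdot\mid S_1(\sigma_1),\dots,S_{t-1}(\sigma_{t-1}))$, where $S_s(1)=Z_s$ and $S_s(-1)=Z_s'$ are the points drawn at the $s$-th node of this path; draws at different nodes of the same level are conditionally independent given the earlier levels. Then, for all $\epsilon>2\alpha>0$, $$\mathbb P\big(\Phi(\mathbf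 Z_1^T)-\mathrm{disc}(\mathbf q)\ge\epsilon\big)\le\mathbb E_{\mathbf v\sim T(\mathbf p)}\big[\mathcal N_1(\alpha,\mathcal F,\mathbf v)\big]\exp\Big(-\frac{(\epsilon-2\alpha)^2}{2M^2\|\mathbf q\|_2^2}\Big).$$ (If $M=0$ or $\mathbf q=0$ the quotient in the exponent is read as $0$; the left side is then $0$.) -/

import Mathlib

open MeasureTheory ProbabilityTheory
open scoped ENNReal

namespace Forecasting

universe u v

/-- Complete binary trees of depth `n` with labels in `α`: a label at the root, followed by two
subtrees of depth `n - 1`. Equivalently, a sequence of maps `z_t : {±1}^(t-1) → α`, `1 ≤ t ≤ n`. -/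
def BTree (α : Type u) : ℕ → Type u
  | 0 => PUnit
  | n + 1 => α × (BTree α n × BTree α n)

namespace BTree

/-- The product σ-algebra on labelled trees. -/
instance instMeasurableSpace (α : Type u) [MeasurableSpace α] :
    (n : ℕ) → MeasurableSpace (BTree α n)
  | 0 => inferInstanceAs (MeasurableSpace PUnit)
  | n + 1 =>
    letI := instMeasurableSpace α n
    inferInstanceAs (MeasurableSpace (α × (BTree α n × BTree α n)))

/-- `z.val σ t` is the label `z_t(σ)` met at step `t` (counted from `0`) when the path `σ` is
followed from the root; `true` stands for the sign `+1` (first subtree), `false` for `-1`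
(second subtree). It depends on the signs `σ s` with `s < t` only. -/
def val {α : Type u} : {n : ℕ} → BTree α n → (Fin n → Bool) → Fin n → α
  | 0, _, _, t => t.elim0
  | _ + 1, (a, l, r), σ, t =>
    Fin.cases a (fun s => val (bif σ 0 then l else r) (fun i => σ i.succ) s) t

/-- Apply a function to every label of a tree. -/
def map {α : Type u} {β : Type v} (g : α → β) : {n : ℕ} → BTree α n → BTree β n
  | 0, _ => PUnit.unit
  | _ + 1, (a, l, r) => (g a, map g l, map g r)

theorem measurable_map {α : Type u} {β : Type v} [MeasurableSpace α] [MeasurableSpace β]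
    {g : α → β} (hg : Measurable g) : ∀ n : ℕ, Measurable (map g : BTree α n → BTree β n)
  | 0 => measurable_const
  | n + 1 => by
    have ih := measurable_map hg n
    exact (hg.comp measurable_fst).prodMk
      ((ih.comp (measurable_fst.comp measurable_snd)).prodMk
        (ih.comp (measurable_snd.comp measurable_snd)))

end BTree

section Law

variable {𝒵 : Type u} [MeasurableSpace 𝒵]

/-- Append a new observation to a history. -/
def extend (k : ℕ) (x : (Fin k → 𝒵) × 𝒵) : Fin (k + 1) → 𝒵 :=
  Fin.snoc (α := fun _ => 𝒵) x.1 x.2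

theorem measurable_extend (k : ℕ) : Measurable (extend (𝒵 := 𝒵) k) := by
  refine measurable_pi_lambda _ fun i => ?_
  refine Fin.lastCases ?_ (fun j => ?_) i
  · simpa [extend] using measurable_snd
  · have h := (measurable_pi_apply j).comp
      (measurable_fst : Measurable (Prod.fst : (Fin k → 𝒵) × 𝒵 → Fin k → 𝒵))
    simpa [extend, Function.comp_def] using h

theorem measurable_extend_fst (k : ℕ) :
    Measurable (fun x : (Fin k → 𝒵) × (𝒵 × 𝒵) => extend k (x.1, x.2.1)) :=
  (measurable_extend k).comp (measurable_fst.prodMk (measurable_fst.comp measurable_snd))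

theorem measurable_extend_snd (k : ℕ) :
    Measurable (fun x : (Fin k → 𝒵) × (𝒵 × 𝒵) => extend k (x.1, x.2.2)) :=
  (measurable_extend k).comp (measurable_fst.prodMk (measurable_snd.comp measurable_snd))

/-- The law of the random `𝒵 × 𝒵`-valued tree of depth `n` grown from a history of length `k`.
Here `p t` is the conditional distribution of the observation with index `t` (counted from `0`)
given the `t` earlier ones. The root label `(Z, Z')` consists of two independent draws from `p k`
given the history; given the root, the first subtree is grown from the history extended by `Z`,
and the second one, independently, from the history extended by `Z'`. -/
noncomputable def pairTreeKernel (p : (t : ℕ) → Kernel (Fin t → 𝒵) 𝒵) :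
    (n k : ℕ) → Kernel (Fin k → 𝒵) (BTree (𝒵 × 𝒵) n)
  | 0, _ => Kernel.const _ (Measure.dirac PUnit.unit)
  | n + 1, k =>
    (Kernel.compProd (Kernel.prod (p k) (p k))
      (Kernel.prod
        ((pairTreeKernel p n (k + 1)).comap _ (measurable_extend_fst k))
        ((pairTreeKernel p n (k + 1)).comap _ (measurable_extend_snd k))) :
      Kernel (Fin k → 𝒵) ((𝒵 × 𝒵) × (BTree (𝒵 × 𝒵) n × BTree (𝒵 × 𝒵) n)))

theorem isMarkovKernel_pairTreeKernel (p : (t : ℕ) → Kernel (Fin t → 𝒵) 𝒵)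
    [∀ t, IsMarkovKernel (p t)] : ∀ n k : ℕ, IsMarkovKernel (pairTreeKernel p n k)
  | 0, _ => ⟨fun _ => by
      rw [pairTreeKernel, Kernel.const_apply]; exact Measure.dirac.isProbabilityMeasure⟩
  | n + 1, k => by
    have ih := isMarkovKernel_pairTreeKernel p n (k + 1)
    rw [pairTreeKernel]
    exact (inferInstance : IsMarkovKernel
      (Kernel.compProd (Kernel.prod (p k) (p k))
        (Kernel.prod
          ((pairTreeKernel p n (k + 1)).comap _ (measurable_extend_fst k))
          ((pairTreeKernel p n (k + 1)).comap _ (measurable_extend_snd k)))))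

/-- The distribution `T(p)` of the `𝒵`-valued tree of depth `T` formed by the first components
of the labels of the tree of pairs grown from the empty history. -/
noncomputable def treeLaw (p : (t : ℕ) → Kernel (Fin t → 𝒵) 𝒵) (T : ℕ) : Measure (BTree 𝒵 T) :=
  (pairTreeKernel p T 0 Fin.elim0).map (BTree.map Prod.fst)

end Law

section Complexity

variable {𝒵 : Type u} {T : ℕ}

/-- `V` is a sequential `α`-cover of `F` on the tree `z`, with respect to the `q`-weighted `ℓ₁`
norm: for all `f ∈ F` and all paths `σ` some `v ∈ V` satisfies
`∑ₜ |v_t(σ) - f (z_t(σ))| ≤ α / ‖q‖_∞`. The norm of `q : Fin T → ℝ` is the sup norm, and the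
inequality is multiplied out, so that every tree covers when `q = 0`. -/
def IsSeqCover (q : Fin T → ℝ) (α : ℝ) (F : Set (𝒵 → ℝ)) (z : BTree 𝒵 T)
    (V : Set (BTree ℝ T)) : Prop :=
  ∀ f ∈ F, ∀ σ : Fin T → Bool, ∃ v ∈ V, ‖q‖ * ∑ t, |v.val σ t - f (z.val σ t)| ≤ α

/-- The sequential covering number `N₁(α, F, z)`: the least size of a sequential `α`-cover of
`F` on `z` (`⊤` if there is no finite one). -/
noncomputable def coveringNumber (q : Fin T → ℝ) (α : ℝ) (F : Set (𝒵 → ℝ)) (z : BTree 𝒵 T) :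
    ℕ∞ :=
  ⨅ (V : Set (BTree ℝ T)) (_ : IsSeqCover q α F z V), V.encard

variable [MeasurableSpace 𝒵]

/-- The expected sequential covering number `E_{v ∼ T(p)} [N₁(α, F, v)]`. -/
noncomputable def expectedCoveringNumber (p : (t : ℕ) → Kernel (Fin t → 𝒵) 𝒵) (q : Fin T → ℝ)
    (α : ℝ) (F : Set (𝒵 → ℝ)) : ℝ≥0∞ :=
  ∫⁻ v, (coveringNumber q α F v : ℝ≥0∞) ∂(treeLaw p T)

/-- `F` is a measurable class for samples of size `T`: for all real weights `a`, the supremum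
`sup_{f ∈ F} ∑ₜ a_t f(z_t)` is measurable in `(z_t)` up to null sets of any probability measure.
This holds for countable classes and for classes with a countable pointwise dense subset. -/
def IsMeasurableClass (T : ℕ) (F : Set (𝒵 → ℝ)) : Prop :=
  ∀ (a : Fin T → ℝ) (μ : Measure (Fin T → 𝒵)) [IsProbabilityMeasure μ],
    AEMeasurable (fun z => ⨆ f : F, ∑ t, a t * f.1 (z t)) μ

/-- The conditional expectation `E[f(Z_t) | Z_s, s < t]` on the trajectory `z`, computed with the
conditional distribution `p t` (indices are counted from `0`). -/
noncomputable def condMean (p : (t : ℕ) → Kernel (Fin t → 𝒵) 𝒵) (f : 𝒵 → ℝ) (t : ℕ)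
    (z : ℕ → 𝒵) : ℝ :=
  ∫ x, f x ∂(p t (fun s : Fin t => z s))

/-- `Φ`: the supremum over `f ∈ F` of the conditional target loss minus the `q`-weighted
empirical loss. The sample has the indices `0, …, T - 1` and the target has the index `T`. -/
noncomputable def supDeviation (p : (t : ℕ) → Kernel (Fin t → 𝒵) 𝒵) (q : Fin T → ℝ)
    (F : Set (𝒵 → ℝ)) (z : ℕ → 𝒵) : ℝ :=
  ⨆ f : F, (condMean p f.1 T z - ∑ t : Fin T, q t * f.1 (z t))

/-- The discrepancy `disc(q)`: the supremum over `f ∈ F` of the conditional target loss minus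
the `q`-weighted sum of the one-step conditional losses. It depends on the trajectory. -/
noncomputable def disc (p : (t : ℕ) → Kernel (Fin t → 𝒵) 𝒵) (q : Fin T → ℝ)
    (F : Set (𝒵 → ℝ)) (z : ℕ → 𝒵) : ℝ :=
  ⨆ f : F, (condMean p f.1 T z - ∑ t : Fin T, q t * condMean p f.1 t z)

end Complexity

end Forecasting

namespace Forecasting

universe u v

/-! The proof is a Chernoff bound after symmetrization, with the complexity of the class read off a
random tree. Since a difference of suprema is at most the supremum of the differences, Φ - disc is
at most the supremum over f of ∑ q_t (E[f(Z_t) | past] - f(Z_t)). So it suffices to control the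
exponential moment of this supremum.

Decoupling: draw a tangent sequence s, conditionally independent copies of the Z_t given their
pasts. For fixed f, Jensen replaces each conditional mean by f(s_t) inside an average over s. A
trajectory paired with its tangent sequence is a path of pairs
(`lintegral_tangentKernel_eq_pairPathKernel`).

Symmetrization: for each sign pattern σ, split ∑ q_t (f(s_t) - f(z_t)) into a signed sum along the
points selected by σ and one along the complementary points. The AM-GM inequality separates the two
halves, at the price of doubling l (`exp_sum_sub_le_sum_signedExpSup`). For fixed σ the selected
points are distributed as the labels met along σ in a tree drawn from T(p), because the two draws at
each node are exchangeable (`lintegral_orientedPath`, `map_selectPath_pairPathKernel`).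

Covering: on a fixed tree, averaging over σ makes each cover element a martingale with increments
bounded by |q_t| M / 2 once it is clipped and centred. Hoeffding's lemma and a union over the cover
give N₁ exp(2lα + l²M²‖q‖₂²/2) (`sum_signedExpSup_le_coveringNumber`). Markov's inequality and the
choice of l finish the proof. -/

/-- The sign attached to a branching decision: `-1` for the first subtree, `1` for the second. -/
def branchSign (b : Bool) : ℝ := bif b then -1 else 1

theorem abs_branchSign (b : Bool) : |branchSign b| = 1 := by
  cases b <;> simp [branchSign]

theorem branchSign_not (b : Bool) : branchSign (!b) = -branchSign b := by
  cases b <;> simp [branchSign]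

/-! ### Paths in trees and Hoeffding's bound for tree martingales. -/

namespace BTree

theorem val_map {α : Type u} {β : Type v} (g : α → β) :
    ∀ {n : ℕ} (w : BTree α n) (σ : Fin n → Bool) (t : Fin n), (map g w).val σ t = g (w.val σ t)
  | 0, _, _, t => t.elim0
  | n + 1, (a, l, r), σ, t => by
    refine Fin.cases rfl (fun s => ?_) t
    have h : (bif σ 0 then map g l else map g r) = map g (bif σ 0 then l else r) := by
      cases σ 0 <;> rfl
    change val (bif σ 0 then map g l else map g r) _ s = g (val (bif σ 0 then l else r) _ s)
    rw [h, val_map g]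

theorem measurable_val {α : Type u} [MeasurableSpace α] :
    ∀ {n : ℕ} (σ : Fin n → Bool) (t : Fin n), Measurable fun w : BTree α n => w.val σ t
  | 0, _, t => t.elim0
  | n + 1, σ, t => by
    refine Fin.cases (measurable_fst (α := α) (β := BTree α n × BTree α n)) (fun s => ?_) t
    have ih := measurable_val (α := α) (fun i => σ i.succ) s
    cases h : σ 0
    · have : (fun w : BTree α (n + 1) => w.val σ s.succ)
          = (fun w : BTree α n => w.val (fun i => σ i.succ) s) ∘
            (fun w : α × (BTree α n × BTree α n) => w.2.2) := by
        funext w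
        change val (bif σ 0 then w.2.1 else w.2.2) _ s = _
        rw [h]; rfl
      rw [this]
      exact ih.comp (measurable_snd.comp measurable_snd)
    · have : (fun w : BTree α (n + 1) => w.val σ s.succ)
          = (fun w : BTree α n => w.val (fun i => σ i.succ) s) ∘
            (fun w : α × (BTree α n × BTree α n) => w.2.1) := by
        funext w
        change val (bif σ 0 then w.2.1 else w.2.2) _ s = _
        rw [h]; rfl
      rw [this]
      exact ih.comp (measurable_fst.comp measurable_snd)

theorem measurable_path {α : Type u} [MeasurableSpace α] {n : ℕ} (σ : Fin n → Bool) :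
    Measurable fun w : BTree α n => w.val σ :=
  measurable_pi_lambda _ fun t => measurable_val σ t

/-- Hoeffding's lemma for the tree martingale `∑ₜ ±cₜ wₜ(σ)` with a uniformly random path `σ`. -/
theorem sum_exp_signed_path_le {B : ℝ} : ∀ {n : ℕ} (w : BTree ℝ n) (c : Fin n → ℝ),
    (∀ σ t, |w.val σ t| ≤ B) →
    ∑ σ : Fin n → Bool, Real.exp (∑ t, branchSign (σ t) * c t * w.val σ t)
      ≤ 2 ^ n * Real.exp (B ^ 2 / 2 * ∑ t, c t ^ 2)
  | 0, _, _, _ => by simp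
  | n + 1, (a, l, r), c, hw => by
    have ha : |a| ≤ B := hw (fun _ => true) 0
    have hsub : ∀ b : Bool, ∀ σ t, |(bif b then l else r).val σ t| ≤ B := fun b σ t =>
      hw (Fin.cons b σ) t.succ
    have key : ∀ b : Bool, ∑ σ : Fin n → Bool, Real.exp (∑ t, branchSign (σ t) * c t.succ *
          (bif b then l else r).val σ t)
        ≤ 2 ^ n * Real.exp (B ^ 2 / 2 * ∑ t : Fin n, c t.succ ^ 2) := fun b =>
      sum_exp_signed_path_le (bif b then l else r) (fun t => c t.succ) (hsub b)
    have hcosh : Real.exp (-(c 0 * a)) + Real.exp (c 0 * a)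
        ≤ 2 * Real.exp (B ^ 2 / 2 * c 0 ^ 2) := by
      have h1 := Real.cosh_le_exp_half_sq (c 0 * a)
      have h2 : Real.exp ((c 0 * a) ^ 2 / 2) ≤ Real.exp (B ^ 2 / 2 * c 0 ^ 2) := by
        apply Real.exp_le_exp.2
        have : a ^ 2 ≤ B ^ 2 := sq_le_sq' (by linarith [neg_abs_le a]) (le_trans (le_abs_self a) ha)
        nlinarith [mul_le_mul_of_nonneg_left this (sq_nonneg (c 0))]
      rw [Real.cosh_eq] at h1
      linarith
    -- The root label precedes every sign, so summing over the first sign produces 2 cosh(c₀ a); the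
    -- bound for the subtrees is the same whichever one is entered.
    rw [← (Fin.consEquiv fun _ : Fin (n + 1) => Bool).sum_comp, Fintype.sum_prod_type]
    have step : ∀ b : Bool, ∀ σ : Fin n → Bool,
        Real.exp (∑ t, branchSign ((Fin.consEquiv fun _ : Fin (n + 1) => Bool) (b, σ) t) * c t *
          val (n := n + 1) (a, l, r) ((Fin.consEquiv fun _ : Fin (n + 1) => Bool) (b, σ)) t)
        = Real.exp (branchSign b * c 0 * a) *
          Real.exp (∑ t, branchSign (σ t) * c t.succ * (bif b then l else r).val σ t) := by
      intro b σ
      rw [Fin.sum_univ_succ, Real.exp_add]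
      rfl
    simp_rw [step, ← Finset.mul_sum]
    calc ∑ b : Bool, Real.exp (branchSign b * c 0 * a) * ∑ σ : Fin n → Bool,
            Real.exp (∑ t, branchSign (σ t) * c t.succ * (bif b then l else r).val σ t)
        ≤ ∑ b : Bool, Real.exp (branchSign b * c 0 * a) *
            (2 ^ n * Real.exp (B ^ 2 / 2 * ∑ t : Fin n, c t.succ ^ 2)) :=
          Finset.sum_le_sum fun b _ => mul_le_mul_of_nonneg_left (key b) (Real.exp_pos _).le
      _ = (Real.exp (-(c 0 * a)) + Real.exp (c 0 * a)) *
            (2 ^ n * Real.exp (B ^ 2 / 2 * ∑ t : Fin n, c t.succ ^ 2)) := by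
          rw [← Finset.sum_mul]; simp [branchSign]
      _ ≤ (2 * Real.exp (B ^ 2 / 2 * c 0 ^ 2)) *
            (2 ^ n * Real.exp (B ^ 2 / 2 * ∑ t : Fin n, c t.succ ^ 2)) := by gcongr
      _ = 2 ^ (n + 1) * Real.exp (B ^ 2 / 2 * ∑ t, c t ^ 2) := by
          rw [Fin.sum_univ_succ, mul_add, Real.exp_add]; ring

end BTree

/-! ### Exponential moments on a fixed tree, bounded by its covering number. -/

section Cover

variable {𝒵 : Type u} {T : ℕ}

/-- The exponential moment integrand of the symmetrized process, with losses centred at `M / 2`,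
on the sample `x` with signs given by `σ`. -/
noncomputable def signedExpSup (q : Fin T → ℝ) (M : ℝ) (F : Set (𝒵 → ℝ)) (l : ℝ)
    (σ : Fin T → Bool) (x : Fin T → 𝒵) : ℝ :=
  Real.exp (2 * l * ((⨆ f : F, ∑ t, branchSign (σ t) * q t * f.1 (x t))
    - M / 2 * ∑ t, branchSign (σ t) * q t))

theorem signedExpSup_nonneg (q : Fin T → ℝ) (M : ℝ) (F : Set (𝒵 → ℝ)) (l : ℝ)
    (σ : Fin T → Bool) (x : Fin T → 𝒵) : 0 ≤ signedExpSup q M F l σ x :=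
  (Real.exp_pos _).le

/-- Projection onto [0, M] is 1-Lipschitz and fixes x. Cover elements are arbitrary real trees;
clipping bounds their increments without spoiling the cover. -/
theorem abs_clip_sub_le {M x y : ℝ} (hx : 0 ≤ x ∧ x ≤ M) : |max 0 (min M y) - x| ≤ |y - x| := by
  rcases le_total M y with h | h
  · rw [min_eq_left h, max_eq_right (hx.1.trans hx.2), abs_of_nonneg (by linarith),
      abs_of_nonneg (by linarith)]
    linarith
  · rw [min_eq_right h]
    rcases le_total 0 y with h' | h'
    · rw [max_eq_right h']
    · rw [max_eq_left h', abs_of_nonpos (by linarith), abs_of_nonpos (by linarith)]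
      linarith

/-- Up to the error α, the supremum over F is a maximum over V, and the exponential of a maximum is
at most the sum of the exponentials. Each summand is a tree martingale covered by
`BTree.sum_exp_signed_path_le`. -/
theorem sum_signedExpSup_le_card {q : Fin T → ℝ} {M : ℝ} {F : Set (𝒵 → ℝ)} (hF : F.Nonempty)
    (hFbdd : ∀ f ∈ F, ∀ z, 0 ≤ f z ∧ f z ≤ M) {α l : ℝ} (hl : 0 ≤ l) (z : BTree 𝒵 T)
    (V : Finset (BTree ℝ T)) (hV : IsSeqCover q α F z (V : Set (BTree ℝ T))) :
    ∑ σ : Fin T → Bool, signedExpSup q M F l σ (z.val σ)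
      ≤ 2 ^ T * (V.card * Real.exp (2 * l * α + l ^ 2 * M ^ 2 * (∑ t, q t ^ 2) / 2)) := by
  have := hF.to_subtype
  obtain ⟨f₀, hf₀⟩ := hF
  set c : ℝ → ℝ := fun y => max 0 (min M y) - M / 2 with hc
  -- A point is needed as argument: if `𝒵` is empty, M may be negative.
  have hM : ∀ z : 𝒵, 0 ≤ M := fun z => (hFbdd f₀ hf₀ z).1.trans (hFbdd f₀ hf₀ z).2
  have path : ∀ σ : Fin T → Bool, signedExpSup q M F l σ (z.val σ) ≤
      Real.exp (2 * l * α) * ∑ v ∈ V,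
        Real.exp (∑ t, branchSign (σ t) * (2 * l * q t) * (v.map c).val σ t) := by
    intro σ
    have hsup : ∃ v ∈ V, (⨆ f : F, ∑ t, branchSign (σ t) * q t * f.1 (z.val σ t))
        - M / 2 * ∑ t, branchSign (σ t) * q t
        ≤ α + ∑ t, branchSign (σ t) * q t * c (v.val σ t) := by
      obtain ⟨v₀, hv₀, -⟩ := hV f₀ hf₀ σ
      -- The maximiser depends on σ but not on f, so a single v serves the whole supremum.
      obtain ⟨v, hv, hmax⟩ := V.exists_max_image
        (fun v => ∑ t, branchSign (σ t) * q t * c (v.val σ t)) ⟨v₀, hv₀⟩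
      refine ⟨v, hv, ?_⟩
      rw [sub_le_iff_le_add]
      refine ciSup_le fun f => ?_
      obtain ⟨v', hv', hcov⟩ := hV f.1 f.2 σ
      refine le_trans ?_ (add_le_add_left (add_le_add_right (hmax v' hv') α) _)
      have : ∑ t, branchSign (σ t) * q t * f.1 (z.val σ t)
          - (∑ t, branchSign (σ t) * q t * c (v'.val σ t)
            + M / 2 * ∑ t, branchSign (σ t) * q t)
          ≤ ‖q‖ * ∑ t, |v'.val σ t - f.1 (z.val σ t)| := by
        rw [Finset.mul_sum, ← Finset.sum_add_distrib, ← Finset.sum_sub_distrib, Finset.mul_sum]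
        refine Finset.sum_le_sum fun t _ => ?_
        calc branchSign (σ t) * q t * f.1 (z.val σ t)
              - (branchSign (σ t) * q t * c (v'.val σ t) + M / 2 * (branchSign (σ t) * q t))
            = -(branchSign (σ t) * q t * (max 0 (min M (v'.val σ t)) - f.1 (z.val σ t))) := by
              simp only [hc]; ring
          _ ≤ |branchSign (σ t) * q t * (max 0 (min M (v'.val σ t)) - f.1 (z.val σ t))| :=
              neg_le_abs _
          _ = |q t| * |max 0 (min M (v'.val σ t)) - f.1 (z.val σ t)| := by
              rw [abs_mul, abs_mul, abs_branchSign, one_mul]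
          _ ≤ ‖q‖ * |v'.val σ t - f.1 (z.val σ t)| :=
              mul_le_mul (norm_le_pi_norm q t) (abs_clip_sub_le (hFbdd f.1 f.2 _))
                (abs_nonneg _) (norm_nonneg _)
      linarith
    obtain ⟨v, hv, hle⟩ := hsup
    calc signedExpSup q M F l σ (z.val σ)
        ≤ Real.exp (2 * l * (α + ∑ t, branchSign (σ t) * q t * c (v.val σ t))) :=
          Real.exp_le_exp.2 (mul_le_mul_of_nonneg_left hle (by positivity))
      _ = Real.exp (2 * l * α) *
            Real.exp (∑ t, branchSign (σ t) * (2 * l * q t) * (v.map c).val σ t) := by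
          rw [← Real.exp_add, mul_add, Finset.mul_sum]
          congr 2
          refine Finset.sum_congr rfl fun t _ => ?_
          rw [BTree.val_map]; ring
      _ ≤ _ := by
          gcongr
          exact Finset.single_le_sum
            (f := fun v => Real.exp (∑ t, branchSign (σ t) * (2 * l * q t) * (v.map c).val σ t))
            (fun _ _ => (Real.exp_pos _).le) hv
  have tree : ∀ v : BTree ℝ T, ∑ σ : Fin T → Bool,
      Real.exp (∑ t, branchSign (σ t) * (2 * l * q t) * (v.map c).val σ t)
      ≤ 2 ^ T * Real.exp (l ^ 2 * M ^ 2 * (∑ t, q t ^ 2) / 2) := by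
    intro v
    -- Centring at M / 2 halves the range: with weights 2lq_t the exponent is (M/2)²/2 · 4l²∑q_t² =
    -- l²M²∑q_t²/2.
    refine (BTree.sum_exp_signed_path_le (B := M / 2) _ _ fun σ t => ?_).trans (le_of_eq ?_)
    · have := hM (z.val σ t)
      rw [BTree.val_map, abs_le]
      simp only [hc]
      constructor
      · linarith [le_max_left 0 (min M (v.val σ t))]
      · linarith [max_le this (min_le_left M (v.val σ t))]
    · congr 2
      simp_rw [mul_pow, ← Finset.mul_sum]
      ring
  calc ∑ σ : Fin T → Bool, signedExpSup q M F l σ (z.val σ)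
      ≤ ∑ σ : Fin T → Bool, Real.exp (2 * l * α) * ∑ v ∈ V,
        Real.exp (∑ t, branchSign (σ t) * (2 * l * q t) * (v.map c).val σ t) :=
        Finset.sum_le_sum fun σ _ => path σ
    _ = Real.exp (2 * l * α) * ∑ v ∈ V, ∑ σ : Fin T → Bool,
        Real.exp (∑ t, branchSign (σ t) * (2 * l * q t) * (v.map c).val σ t) := by
        rw [← Finset.mul_sum, Finset.sum_comm]
    _ ≤ Real.exp (2 * l * α) *
          ∑ v ∈ V, 2 ^ T * Real.exp (l ^ 2 * M ^ 2 * (∑ t, q t ^ 2) / 2) := by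
        gcongr with v
        exact tree v
    _ = _ := by
        rw [Finset.sum_const, nsmul_eq_mul, Real.exp_add]; ring

/-- The infimum is attained because `ℕ∞` is well-ordered, and the family of covers is non-empty
because all trees together form one. -/
theorem exists_isSeqCover_encard_eq (q : Fin T → ℝ) {α : ℝ} (hα : 0 ≤ α) (F : Set (𝒵 → ℝ))
    (z : BTree 𝒵 T) :
    ∃ V : Set (BTree ℝ T), IsSeqCover q α F z V ∧ V.encard = coveringNumber q α F z := by
  have huniv : IsSeqCover q α F z Set.univ := fun f _ σ =>
    ⟨z.map f, Set.mem_univ _, by simpa [BTree.val_map] using hα⟩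
  have : Nonempty {V : Set (BTree ℝ T) // IsSeqCover q α F z V} := ⟨⟨_, huniv⟩⟩
  obtain ⟨V, hV⟩ := ciInf_mem
    fun V : {V : Set (BTree ℝ T) // IsSeqCover q α F z V} => V.1.encard
  refine ⟨V.1, V.2, ?_⟩
  rw [coveringNumber, iInf_subtype']
  exact hV

theorem sum_signedExpSup_le_coveringNumber {q : Fin T → ℝ} {M : ℝ} {F : Set (𝒵 → ℝ)}
    (hF : F.Nonempty) (hFbdd : ∀ f ∈ F, ∀ z, 0 ≤ f z ∧ f z ≤ M) {α l : ℝ} (hα : 0 ≤ α)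
    (hl : 0 ≤ l) (z : BTree 𝒵 T) :
    ∑ σ : Fin T → Bool, ENNReal.ofReal (signedExpSup q M F l σ (z.val σ))
      ≤ 2 ^ T * ((coveringNumber q α F z : ℝ≥0∞) *
        ENNReal.ofReal (Real.exp (2 * l * α + l ^ 2 * M ^ 2 * (∑ t, q t ^ 2) / 2))) := by
  obtain ⟨V, hV, hcard⟩ := exists_isSeqCover_encard_eq q hα F z
  rw [← hcard]
  by_cases hfin : V.Finite
  · lift V to Finset (BTree ℝ T) using hfin
    rw [← ENNReal.ofReal_sum_of_nonneg fun σ _ => signedExpSup_nonneg _ _ _ _ _ _]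
    refine (ENNReal.ofReal_le_ofReal
      (sum_signedExpSup_le_card hF hFbdd hl z V hV)).trans (le_of_eq ?_)
    rw [ENNReal.ofReal_mul (by positivity), ENNReal.ofReal_mul (by positivity),
      ENNReal.ofReal_pow (by norm_num), ENNReal.ofReal_natCast, Set.encard_coe_eq_coe_finsetCard]
    simp
  · have hinf : V.encard = ⊤ := Set.encard_eq_top_iff.2 hfin
    rw [hinf, ENat.toENNReal_top, ENNReal.top_mul, ENNReal.mul_top]
    · exact le_top
    · positivity
    · simpa using Real.exp_pos _

end Cover

/-! ### Histories and oriented paths of pairs. -/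

section Extend

variable {𝒵 : Type u}

theorem extend_history (k : ℕ) (z : ℕ → 𝒵) :
    extend k (fun s : Fin k => z s, z k) = fun s : Fin (k + 1) => z s := by
  funext i
  refine Fin.lastCases ?_ (fun j => ?_) i <;> simp [extend]

theorem init_extend (k : ℕ) (x : (Fin k → 𝒵) × 𝒵) :
    (fun i : Fin k => extend k x i.castSucc) = x.1 := by
  funext i; simp [extend]

theorem extend_last (k : ℕ) (x : (Fin k → 𝒵) × 𝒵) : extend k x (Fin.last k) = x.2 := by
  simp [extend]

/-- The labels along the path `σ` of a tree of pairs, each ordered so that its first component is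
the one chosen by `σ`. -/
def orientedPath {n : ℕ} (σ : Fin n → Bool) (w : BTree (𝒵 × 𝒵) n) : Fin n → 𝒵 × 𝒵 :=
  fun t => bif σ t then w.val σ t else (w.val σ t).swap

theorem orientedPath_succ {n : ℕ} (σ : Fin (n + 1) → Bool) (x x' : 𝒵) (a b : BTree (𝒵 × 𝒵) n) :
    orientedPath (n := n + 1) σ ((x, x'), (a, b))
      = Fin.cons (bif σ 0 then (x, x') else (x', x))
          (orientedPath (fun i => σ i.succ) (bif σ 0 then a else b)) := by
  funext t
  refine Fin.cases ?_ (fun s => ?_) t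
  · rfl
  · rfl

end Extend

/-! ### Laws of pair trees, pair paths and tangent sequences; decoupling. -/

section Kernels

variable {𝒵 : Type u} [MeasurableSpace 𝒵]

attribute [instance] isMarkovKernel_pairTreeKernel

theorem measurable_fin_cons {β : Type u} [MeasurableSpace β] (n : ℕ) :
    Measurable fun x : β × (Fin n → β) => (Fin.cons x.1 x.2 : Fin (n + 1) → β) := by
  refine measurable_pi_lambda _ fun i => ?_
  refine Fin.cases ?_ (fun j => ?_) i
  · simpa using measurable_fst
  · simpa [Function.comp_def] using (measurable_pi_apply j).comp (measurable_snd (α := β))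

theorem measurable_history (k : ℕ) : Measurable fun (z : ℕ → 𝒵) (s : Fin k) => z s :=
  measurable_pi_lambda _ fun s => measurable_pi_apply (s : ℕ)

/-- The law of a path of length `n` of pairs `(Z, Z')` grown from a history of length `k`, where
`Z` continues the history and `Z'` is an independent copy of it given the past. -/
noncomputable def pairPathKernel (p : (t : ℕ) → Kernel (Fin t → 𝒵) 𝒵) :
    (n k : ℕ) → Kernel (Fin k → 𝒵) (Fin n → 𝒵 × 𝒵)
  | 0, _ => Kernel.const _ (Measure.dirac Fin.elim0)
  | n + 1, k =>
    (Kernel.compProd (Kernel.prod (p k) (p k))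
      ((pairPathKernel p n (k + 1)).comap _ (measurable_extend_fst k))).map
      fun x => (Fin.cons x.1 x.2 : Fin (n + 1) → 𝒵 × 𝒵)

/-- The law of the tangent sequence on the trajectory `z`: independent draws from the conditional
distributions of the observations with indices `k, …, k + n - 1`. -/
noncomputable def tangentKernel (p : (t : ℕ) → Kernel (Fin t → 𝒵) 𝒵) :
    (n k : ℕ) → Kernel (ℕ → 𝒵) (Fin n → 𝒵)
  | 0, _ => Kernel.const _ (Measure.dirac Fin.elim0)
  | n + 1, k =>
    (Kernel.prod ((p k).comap _ (measurable_history k)) (tangentKernel p n (k + 1))).map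
      fun x => (Fin.cons x.1 x.2 : Fin (n + 1) → 𝒵)

variable (p : (t : ℕ) → Kernel (Fin t → 𝒵) 𝒵) [∀ t, IsMarkovKernel (p t)]

instance isMarkovKernel_pairPathKernel : ∀ n k : ℕ, IsMarkovKernel (pairPathKernel p n k)
  | 0, k => by rw [pairPathKernel]; infer_instance
  | n + 1, k => by
    have := isMarkovKernel_pairPathKernel n (k + 1)
    rw [pairPathKernel]
    exact Kernel.IsMarkovKernel.map _ (measurable_fin_cons n)

instance isMarkovKernel_tangentKernel : ∀ n k : ℕ, IsMarkovKernel (tangentKernel p n k)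
  | 0, k => by rw [tangentKernel]; infer_instance
  | n + 1, k => by
    have := isMarkovKernel_tangentKernel n (k + 1)
    rw [tangentKernel]
    exact Kernel.IsMarkovKernel.map _ (measurable_fin_cons n)

theorem lintegral_pairTreeKernel_succ (n k : ℕ) (h : Fin k → 𝒵)
    {G : (𝒵 × 𝒵) × (BTree (𝒵 × 𝒵) n × BTree (𝒵 × 𝒵) n) → ℝ≥0∞} (hG : Measurable G) :
    ∫⁻ w, G w ∂(pairTreeKernel p (n + 1) k h)
      = ∫⁻ x, ∫⁻ x', ∫⁻ a, ∫⁻ b, G ((x, x'), (a, b)) ∂(pairTreeKernel p n (k + 1) (extend k (h, x')))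
          ∂(pairTreeKernel p n (k + 1) (extend k (h, x))) ∂(p k h) ∂(p k h) := by
  rw [pairTreeKernel]
  refine (Kernel.lintegral_compProd _ _ _ hG).trans ?_
  rw [Kernel.lintegral_prod _ _ _ (Measurable.lintegral_kernel_prod_right''
    (η := ((pairTreeKernel p n (k + 1)).comap _ (measurable_extend_fst k)).prod
        ((pairTreeKernel p n (k + 1)).comap _ (measurable_extend_snd k))) (a := h) hG)]
  refine lintegral_congr fun x => lintegral_congr fun x' => ?_
  have hGx : Measurable fun y => G ((x, x'), y) := hG.comp measurable_prodMk_left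
  rw [Kernel.lintegral_prod _ _ _ hGx]
  rfl

theorem lintegral_pairPathKernel_succ (n k : ℕ) (h : Fin k → 𝒵)
    {G : (Fin (n + 1) → 𝒵 × 𝒵) → ℝ≥0∞} (hG : Measurable G) :
    ∫⁻ y, G y ∂(pairPathKernel p (n + 1) k h)
      = ∫⁻ x, ∫⁻ x', ∫⁻ y, G (Fin.cons (x, x') y) ∂(pairPathKernel p n (k + 1) (extend k (h, x)))
          ∂(p k h) ∂(p k h) := by
  have hG' : Measurable fun x : (𝒵 × 𝒵) × (Fin n → 𝒵 × 𝒵) => G (Fin.cons x.1 x.2) :=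
    hG.comp (measurable_fin_cons n)
  rw [pairPathKernel, Kernel.lintegral_map _ (measurable_fin_cons n) _ hG,
    Kernel.lintegral_compProd _ _ _ hG',
    Kernel.lintegral_prod _ _ _ (Measurable.lintegral_kernel_prod_right''
      (η := (pairPathKernel p n (k + 1)).comap _ (measurable_extend_fst k)) (a := h) hG')]
  rfl

theorem lintegral_tangentKernel_succ (n k : ℕ) (z : ℕ → 𝒵)
    {G : (Fin (n + 1) → 𝒵) → ℝ≥0∞} (hG : Measurable G) :
    ∫⁻ y, G y ∂(tangentKernel p (n + 1) k z)
      = ∫⁻ x, ∫⁻ y, G (Fin.cons x y) ∂(tangentKernel p n (k + 1) z)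
          ∂(p k fun s : Fin k => z s) := by
  have hG' : Measurable fun x : 𝒵 × (Fin n → 𝒵) => G (Fin.cons x.1 x.2) :=
    hG.comp (measurable_fin_cons n)
  rw [tangentKernel, Kernel.lintegral_map _ (measurable_fin_cons n) _ hG,
    Kernel.lintegral_prod _ _ _ hG']
  rfl

/-- This marginal law turns the mean of f(s_t) under the tangent law into the conditional mean of
f(Z_t). -/
theorem map_eval_tangentKernel : ∀ (n k : ℕ) (z : ℕ → 𝒵) (i : Fin n),
    (tangentKernel p n k z).map (fun y => y i)
      = p (k + (i : ℕ)) fun s : Fin (k + (i : ℕ)) => z s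
  | 0, _, _, i => i.elim0
  | n + 1, k, z, i => by
    rw [tangentKernel, Kernel.map_apply _ (measurable_fin_cons n), Kernel.prod_apply,
      Measure.map_map (measurable_pi_apply i) (measurable_fin_cons n)]
    refine Fin.cases ?_ (fun j => ?_) i
    · have : ((fun y : Fin (n + 1) → 𝒵 => y 0) ∘
          fun x : 𝒵 × (Fin n → 𝒵) => (Fin.cons x.1 x.2 : Fin (n + 1) → 𝒵)) = Prod.fst := rfl
      rw [this, Measure.map_fst_prod, measure_univ, one_smul]
      rfl
    · have : ((fun y : Fin (n + 1) → 𝒵 => y j.succ) ∘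
          fun x : 𝒵 × (Fin n → 𝒵) => (Fin.cons x.1 x.2 : Fin (n + 1) → 𝒵))
          = (fun y : Fin n → 𝒵 => y j) ∘ Prod.snd := rfl
      rw [this, ← Measure.map_map (measurable_pi_apply j) measurable_snd, Measure.map_snd_prod,
        measure_univ, one_smul, map_eval_tangentKernel n (k + 1) z j]
      have cast : ∀ a b : ℕ, a = b →
          (p a fun s : Fin a => z s) = p b fun s : Fin b => z s := by
        rintro a _ rfl; rfl
      exact cast _ _ (by rw [Fin.val_succ]; omega)

theorem measurable_orientedPath {n : ℕ} (σ : Fin n → Bool) :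
    Measurable (orientedPath (𝒵 := 𝒵) σ) := by
  refine measurable_pi_lambda _ fun t => ?_
  unfold orientedPath
  cases σ t
  · exact measurable_swap.comp (BTree.measurable_val σ t)
  · exact BTree.measurable_val σ t

/-- Along a fixed path only one subtree is visited at each node; the other integrates to 1. When the
path takes the second subtree, swapping the two draws, which are independent with the same law,
restores the order in which the first component continues the history. -/
theorem lintegral_orientedPath : ∀ (n k : ℕ) (h : Fin k → 𝒵) (σ : Fin n → Bool)
    {G : (Fin n → 𝒵 × 𝒵) → ℝ≥0∞}, Measurable G →
    ∫⁻ w, G (orientedPath σ w) ∂(pairTreeKernel p n k h) = ∫⁻ y, G y ∂(pairPathKernel p n k h)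
  | 0, k, h, σ, G, hG => by
    have : ∀ y, G y = G Fin.elim0 := fun y => congrArg G (Subsingleton.elim _ _)
    simp_rw [this]
    rw [lintegral_const, lintegral_const, measure_univ, measure_univ]
  | n + 1, k, h, σ, G, hG => by
    have hcons : ∀ x : 𝒵 × 𝒵, Measurable fun y : Fin n → 𝒵 × 𝒵 => G (Fin.cons x y) := fun x =>
      (hG.comp (measurable_fin_cons n)).comp measurable_prodMk_left
    refine (lintegral_pairTreeKernel_succ p n k h
      (hG.comp (measurable_orientedPath (n := n + 1) σ))).trans ?_
    rw [lintegral_pairPathKernel_succ p n k h hG]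
    have hw : ∀ x x' (a b : BTree (𝒵 × 𝒵) n),
        (G ∘ orientedPath (n := n + 1) σ) ((x, x'), (a, b))
          = G (Fin.cons (bif σ 0 then (x, x') else (x', x))
            (orientedPath (fun i => σ i.succ) (bif σ 0 then a else b))) := fun x x' a b =>
      congrArg G (orientedPath_succ σ x x' a b)
    refine (lintegral_congr fun x => lintegral_congr fun x' => lintegral_congr fun a =>
      lintegral_congr fun b => hw x x' a b).trans ?_
    cases σ 0
    · simp only [cond_false]
      have ih : ∀ x x', ∫⁻ b, G (Fin.cons (x', x) (orientedPath (fun i => σ i.succ) b))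
          ∂(pairTreeKernel p n (k + 1) (extend k (h, x')))
          = ∫⁻ y, G (Fin.cons (x', x) y) ∂(pairPathKernel p n (k + 1) (extend k (h, x'))) :=
        fun x x' => lintegral_orientedPath n (k + 1) _ _ (hcons (x', x))
      simp only [ih, lintegral_const, measure_univ, mul_one]
      -- Exchangeability of the two root draws is Tonelli's theorem for `p k h` with itself.
      refine lintegral_lintegral_swap (Measurable.aemeasurable ?_)
      have hsw : Measurable fun u : (𝒵 × 𝒵) × (Fin n → 𝒵 × 𝒵) =>
          G (Fin.cons (u.1.2, u.1.1) u.2) :=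
        (hG.comp (measurable_fin_cons n)).comp
          ((measurable_swap.comp measurable_fst).prodMk measurable_snd)
      exact Measurable.lintegral_kernel_prod_right''
        (η := (pairPathKernel p n (k + 1)).comap _ (measurable_extend_snd k)) (a := h) hsw
    · simp only [cond_true, lintegral_const, measure_univ, mul_one]
      refine lintegral_congr fun x => lintegral_congr fun x' => ?_
      exact lintegral_orientedPath n (k + 1) _ _ (hcons (x, x'))

theorem map_orientedPath (n k : ℕ) (h : Fin k → 𝒵) (σ : Fin n → Bool) :
    (pairTreeKernel p n k h).map (orientedPath σ) = pairPathKernel p n k h := by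
  refine Measure.ext_of_lintegral _ fun G hG => ?_
  rw [lintegral_map hG (measurable_orientedPath σ)]
  exact lintegral_orientedPath p n k h σ hG

/-- Decoupling: a trajectory together with its tangent sequence is a path of pairs. -/
theorem lintegral_tangentKernel_eq_pairPathKernel {ν : Measure (ℕ → 𝒵)} [IsProbabilityMeasure ν]
    {N : ℕ} (hν : ∀ t < N, HasCondDistrib (fun z : ℕ → 𝒵 => z t) (fun z (s : Fin t) => z s) (p t) ν) :
    ∀ (n k : ℕ), k + n ≤ N → ∀ {G : (Fin k → 𝒵) × (Fin n → 𝒵 × 𝒵) → ℝ≥0∞}, Measurable G →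
    ∫⁻ z, ∫⁻ s, G (fun i => z i, fun i => (z (k + i), s i)) ∂(tangentKernel p n k z) ∂ν
      = ∫⁻ z, ∫⁻ y, G (fun i => z i, y) ∂(pairPathKernel p n k fun i : Fin k => z i) ∂ν
  | 0, k, _, G, _ => by
    have : ∀ (h : Fin k → 𝒵) y, G (h, y) = G (h, Fin.elim0) := fun h y =>
      congrArg (fun y => G (h, y)) (Subsingleton.elim _ _)
    refine lintegral_congr fun z => ?_
    simp_rw [this (fun i : Fin k => z i)]
    rw [lintegral_const, lintegral_const, measure_univ, measure_univ]
  | n + 1, k, hk, G, hG => by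
    -- integrate out the first tangent variable and apply the induction hypothesis
    let G' : (Fin (k + 1) → 𝒵) × (Fin n → 𝒵 × 𝒵) → ℝ≥0∞ := fun u =>
      ∫⁻ x', G (fun i => u.1 i.castSucc, Fin.cons (u.1 (Fin.last k), x') u.2)
        ∂(p k fun i => u.1 i.castSucc)
    have hinit : Measurable fun (h : Fin (k + 1) → 𝒵) (i : Fin k) => h i.castSucc :=
      measurable_pi_lambda _ fun i => measurable_pi_apply _
    have hG' : Measurable G' := by
      have : Measurable fun u : ((Fin (k + 1) → 𝒵) × (Fin n → 𝒵 × 𝒵)) × 𝒵 =>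
          G (fun i => u.1.1 i.castSucc, Fin.cons (u.1.1 (Fin.last k), u.2) u.1.2) := by
        refine hG.comp ((hinit.comp (measurable_fst.comp measurable_fst)).prodMk
          ((measurable_fin_cons n).comp (Measurable.prodMk (Measurable.prodMk ?_ measurable_snd)
            (measurable_snd.comp measurable_fst))))
        exact (measurable_pi_apply _).comp (measurable_fst.comp measurable_fst)
      exact Measurable.lintegral_kernel_prod_right'
        (κ := (p k).comap _ (hinit.comp measurable_fst)) this
    have hGz : ∀ z : ℕ → 𝒵, Measurable fun u : 𝒵 × (Fin n → 𝒵) => G (fun i => z i,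
        fun i => (z (k + i), (Fin.cons u.1 u.2 : Fin (n + 1) → 𝒵) i)) := fun z => by
      refine hG.comp (measurable_const.prodMk (measurable_pi_lambda _ fun i =>
        measurable_const.prodMk ((measurable_pi_apply i).comp (measurable_fin_cons n))))
    have hcons : ∀ (z : ℕ → 𝒵) (x : 𝒵) (s : Fin n → 𝒵),
        (fun i : Fin (n + 1) => (z (k + i), (Fin.cons x s : Fin (n + 1) → 𝒵) i))
          = Fin.cons (z k, x) fun i : Fin n => (z (k + 1 + i), s i) := by
      intro z x s
      funext i
      refine Fin.cases ?_ (fun j => ?_) i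
      · rfl
      · simp only [Fin.cons_succ, Fin.val_succ]
        rw [show k + ((j : ℕ) + 1) = k + 1 + j by omega]
    calc ∫⁻ z, ∫⁻ s, G (fun i => z i, fun i => (z (k + i), s i)) ∂(tangentKernel p (n + 1) k z) ∂ν
        = ∫⁻ z, ∫⁻ s, G' (fun i => z i, fun i => (z (k + 1 + i), s i))
            ∂(tangentKernel p n (k + 1) z) ∂ν := by
          refine lintegral_congr fun z => ?_
          have hGs : Measurable fun s : Fin (n + 1) → 𝒵 =>
              G (fun i => z i, fun i => (z (k + i), s i)) :=
            hG.comp (measurable_const.prodMk (measurable_pi_lambda _ fun i =>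
              measurable_const.prodMk (measurable_pi_apply i)))
          rw [lintegral_tangentKernel_succ p n k z hGs, lintegral_lintegral_swap (hGz z).aemeasurable]
          simp only [hcons]
          rfl
      _ = ∫⁻ z, ∫⁻ y, G' (fun i => z i, y)
            ∂(pairPathKernel p n (k + 1) fun i : Fin (k + 1) => z i) ∂ν :=
          lintegral_tangentKernel_eq_pairPathKernel hν n (k + 1) (by omega) hG'
      _ = ∫⁻ z, ∫⁻ x, ∫⁻ y, G' (extend k (fun i : Fin k => z i, x), y)
            ∂(pairPathKernel p n (k + 1) (extend k (fun i : Fin k => z i, x)))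
            ∂(p k fun i : Fin k => z i) ∂ν := by
          have hg : Measurable fun u : (Fin k → 𝒵) × 𝒵 => ∫⁻ y, G' (extend k u, y)
              ∂(pairPathKernel p n (k + 1) (extend k u)) :=
            Measurable.lintegral_kernel_prod_right'
              (κ := (pairPathKernel p n (k + 1)).comap _ (measurable_extend k))
              (hG'.comp (((measurable_extend k).comp measurable_fst).prodMk measurable_snd))
          -- The remaining integrand depends only on the first k + 1 observations, so z_k can be
          -- disintegrated given the first k.
          have hlaw := hν k (by omega)
          have := lintegral_map' (μ := ν) (f := fun u : (Fin k → 𝒵) × 𝒵 =>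
            ∫⁻ y, G' (extend k u, y) ∂(pairPathKernel p n (k + 1) (extend k u)))
            hg.aemeasurable hlaw.aemeasurable
          simp only [extend_history] at this
          rw [← this, hlaw.map_eq, Measure.lintegral_compProd hg,
            lintegral_map (Measurable.lintegral_kernel_prod_right' hg) (measurable_history k)]
      _ = _ := by
          refine lintegral_congr fun z => ?_
          have hGy : Measurable fun y => G (fun i : Fin k => z i, y) :=
            hG.comp measurable_prodMk_left
          rw [lintegral_pairPathKernel_succ p n k _ hGy]
          refine lintegral_congr fun x => ?_
          simp only [G', init_extend, extend_last]
          refine lintegral_lintegral_swap (Measurable.aemeasurable ?_)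
          refine hG.comp (measurable_const.prodMk ((measurable_fin_cons n).comp
            ((measurable_const.prodMk measurable_snd).prodMk measurable_fst)))

end Kernels

/-! ### Pointwise symmetrization over sign patterns. -/

section Symmetrization

variable {𝒵 : Type u} {T : ℕ}

/-- Select the first component of the pairs where `σ` is `true` and the second one elsewhere. -/
def selectPath (σ : Fin T → Bool) (y : Fin T → 𝒵 × 𝒵) : Fin T → 𝒵 :=
  fun t => bif σ t then (y t).1 else (y t).2

theorem bddAbove_range_sum {F : Set (𝒵 → ℝ)} {M : ℝ} (hFbdd : ∀ f ∈ F, ∀ z, 0 ≤ f z ∧ f z ≤ M)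
    (a : Fin T → ℝ) (x : Fin T → 𝒵) :
    BddAbove (Set.range fun f : F => ∑ t, a t * f.1 (x t)) := by
  refine ⟨∑ t, |a t| * M, ?_⟩
  rintro _ ⟨f, rfl⟩
  refine Finset.sum_le_sum fun t _ => ?_
  have h := hFbdd f.1 f.2 (x t)
  exact mul_le_mul (le_abs_self _) h.2 h.1 (abs_nonneg _)

/-- A pattern and its complement select complementary points with opposite signs, so their signed
sums add up to the full difference and the centring terms cancel. Then 2ab ≤ a² + b² separates the
two exponentials, and the squares account for the factor 2 in `signedExpSup`. The sum over σ is
invariant under complementation. -/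
theorem exp_sum_sub_le_sum_signedExpSup {F : Set (𝒵 → ℝ)} {M l : ℝ}
    (hFbdd : ∀ f ∈ F, ∀ z, 0 ≤ f z ∧ f z ≤ M) (q : Fin T → ℝ) (hl : 0 ≤ l) {f : 𝒵 → ℝ}
    (hf : f ∈ F) (y : Fin T → 𝒵 × 𝒵) :
    2 ^ T * Real.exp (l * ∑ t, q t * (f (y t).2 - f (y t).1))
      ≤ ∑ σ : Fin T → Bool, signedExpSup q M F l σ (selectPath σ y) := by
  set E : (Fin T → Bool) → ℝ := fun σ => signedExpSup q M F l σ (selectPath σ y)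
  set A : (Fin T → Bool) → ℝ := fun σ => ∑ t, branchSign (σ t) * q t * f (selectPath σ y t)
    - M / 2 * ∑ t, branchSign (σ t) * q t with hA
  have hE : ∀ σ, Real.exp (l * A σ) ^ 2 ≤ E σ := by
    intro σ
    rw [← Real.exp_nat_mul]
    apply Real.exp_le_exp.2
    have := le_ciSup (bddAbove_range_sum hFbdd (fun t => branchSign (σ t) * q t)
      (selectPath σ y)) ⟨f, hf⟩
    have h2 : A σ ≤ (⨆ f : F, ∑ t, branchSign (σ t) * q t * f.1 (selectPath σ y t))
      - M / 2 * ∑ t, branchSign (σ t) * q t := sub_le_sub_right this _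
    push_cast
    rw [mul_assoc 2 l]
    exact mul_le_mul_of_nonneg_left (mul_le_mul_of_nonneg_left h2 hl) zero_le_two |>.trans
      (le_of_eq (by ring))
  have hsum : ∀ σ : Fin T → Bool, A σ + A (fun t => !σ t)
      = ∑ t, q t * (f (y t).2 - f (y t).1) := by
    intro σ
    simp only [hA, Finset.mul_sum, ← Finset.sum_sub_distrib, ← Finset.sum_add_distrib]
    refine Finset.sum_congr rfl fun t _ => ?_
    rw [branchSign_not]
    cases h : σ t <;> simp [selectPath, branchSign, h] <;> ring
  have hpt : ∀ σ : Fin T → Bool, Real.exp (l * ∑ t, q t * (f (y t).2 - f (y t).1))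
      ≤ (E σ + E (fun t => !σ t)) / 2 := by
    intro σ
    rw [← hsum σ, mul_add, Real.exp_add]
    have h1 := hE σ
    have h2 := hE fun t => !σ t
    nlinarith [sq_nonneg (Real.exp (l * A σ) - Real.exp (l * A fun t => !σ t))]
  have hflip : ∑ σ : Fin T → Bool, E (fun t => !σ t) = ∑ σ, E σ :=
    (Equiv.arrowCongr (Equiv.refl (Fin T)) Equiv.boolNot).sum_comp E
  calc 2 ^ T * Real.exp (l * ∑ t, q t * (f (y t).2 - f (y t).1))
      = ∑ _σ : Fin T → Bool, Real.exp (l * ∑ t, q t * (f (y t).2 - f (y t).1)) := by simp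
    _ ≤ ∑ σ : Fin T → Bool, (E σ + E (fun t => !σ t)) / 2 := Finset.sum_le_sum fun σ _ => hpt σ
    _ = ∑ σ, E σ := by
        rw [← Finset.sum_div, Finset.sum_add_distrib, hflip]; ring

end Symmetrization

/-! ### From pair paths to the tree law, and the exponential majorant. -/

section Expectation

variable {𝒵 : Type u} [MeasurableSpace 𝒵] {T : ℕ}

theorem measurable_selectPath (σ : Fin T → Bool) : Measurable (selectPath (𝒵 := 𝒵) σ) := by
  refine measurable_pi_lambda _ fun t => ?_
  unfold selectPath
  cases σ t
  · exact measurable_snd.comp (measurable_pi_apply t)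
  · exact measurable_fst.comp (measurable_pi_apply t)

theorem aemeasurable_signedExpSup {F : Set (𝒵 → ℝ)} (hFsup : IsMeasurableClass T F)
    (q : Fin T → ℝ) (M l : ℝ) (σ : Fin T → Bool) (μ : Measure (Fin T → 𝒵))
    [IsProbabilityMeasure μ] : AEMeasurable (signedExpSup q M F l σ) μ :=
  Real.measurable_exp.comp_aemeasurable
    (((hFsup (fun t => branchSign (σ t) * q t) μ).sub_const _).const_mul _)

variable (p : (t : ℕ) → Kernel (Fin t → 𝒵) 𝒵) [∀ t, IsMarkovKernel (p t)]

/-- Orienting by σ and then selecting by σ undo each other: what remains is the first component of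
each label along the path. -/
theorem map_selectPath_pairPathKernel (σ : Fin T → Bool) :
    (pairPathKernel p T 0 Fin.elim0).map (selectPath σ)
      = (treeLaw p T).map fun v => v.val σ := by
  rw [← map_orientedPath p T 0 Fin.elim0 σ, treeLaw,
    Measure.map_map (measurable_selectPath σ) (measurable_orientedPath σ),
    Measure.map_map (BTree.measurable_path σ) (BTree.measurable_map measurable_fst T)]
  congr 1
  funext w t
  simp only [Function.comp_apply, BTree.val_map, selectPath, orientedPath]
  cases σ t <;> rfl

instance isProbabilityMeasure_treeLaw : IsProbabilityMeasure (treeLaw p T) :=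
  Measure.isProbabilityMeasure_map (BTree.measurable_map measurable_fst T).aemeasurable

theorem aemeasurable_signedExpSup_selectPath {F : Set (𝒵 → ℝ)} (hFsup : IsMeasurableClass T F)
    (q : Fin T → ℝ) (M l : ℝ) (σ : Fin T → Bool) :
    AEMeasurable (fun y => ENNReal.ofReal (signedExpSup q M F l σ (selectPath σ y)))
      (pairPathKernel p T 0 Fin.elim0) := by
  have := Measure.isProbabilityMeasure_map (μ := pairPathKernel p T 0 Fin.elim0)
    (measurable_selectPath (𝒵 := 𝒵) σ).aemeasurable
  exact ((aemeasurable_signedExpSup hFsup q M l σ _).comp_measurable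
    (measurable_selectPath σ)).ennreal_ofReal

theorem lintegral_sum_signedExpSup_le {F : Set (𝒵 → ℝ)} (hF : F.Nonempty) {M : ℝ}
    (hFbdd : ∀ f ∈ F, ∀ z, 0 ≤ f z ∧ f z ≤ M) (hFsup : IsMeasurableClass T F)
    (q : Fin T → ℝ) {α l : ℝ} (hα : 0 ≤ α) (hl : 0 ≤ l) :
    ∫⁻ y, ∑ σ : Fin T → Bool, ENNReal.ofReal (signedExpSup q M F l σ (selectPath σ y))
        ∂(pairPathKernel p T 0 Fin.elim0)
      ≤ 2 ^ T * (expectedCoveringNumber p q α F *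
        ENNReal.ofReal (Real.exp (2 * l * α + l ^ 2 * M ^ 2 * (∑ t, q t ^ 2) / 2))) := by
  have hprob : ∀ σ : Fin T → Bool,
      IsProbabilityMeasure ((treeLaw p T).map fun v => v.val σ) := fun σ =>
    Measure.isProbabilityMeasure_map (BTree.measurable_path σ).aemeasurable
  have hmeas : ∀ σ : Fin T → Bool, AEMeasurable
      (fun x => ENNReal.ofReal (signedExpSup q M F l σ x))
      ((treeLaw p T).map fun v => v.val σ) := fun σ =>
    (aemeasurable_signedExpSup hFsup q M l σ _).ennreal_ofReal
  have hterm : ∀ σ : Fin T → Bool,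
      ∫⁻ y, ENNReal.ofReal (signedExpSup q M F l σ (selectPath σ y))
        ∂(pairPathKernel p T 0 Fin.elim0)
      = ∫⁻ v, ENNReal.ofReal (signedExpSup q M F l σ (v.val σ)) ∂(treeLaw p T) := by
    intro σ
    have h := hmeas σ
    rw [← lintegral_map' h (BTree.measurable_path σ).aemeasurable]
    rw [← map_selectPath_pairPathKernel] at h ⊢
    rw [lintegral_map' h (measurable_selectPath σ).aemeasurable]
  have hpath : ∀ σ : Fin T → Bool, AEMeasurable
      (fun v : BTree 𝒵 T => ENNReal.ofReal (signedExpSup q M F l σ (v.val σ))) (treeLaw p T) :=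
    fun σ => (hmeas σ).comp_measurable (BTree.measurable_path σ)
  rw [lintegral_finsetSum' _ fun σ _ => aemeasurable_signedExpSup_selectPath p hFsup q M l σ,
    Finset.sum_congr rfl fun σ _ => hterm σ, ← lintegral_finsetSum' _ fun σ _ => hpath σ]
  -- Neither monotonicity nor extraction of finite constants needs the covering number to be
  -- measurable.
  refine (lintegral_mono fun v =>
    sum_signedExpSup_le_coveringNumber hF hFbdd hα hl v).trans (le_of_eq ?_)
  rw [lintegral_const_mul' _ _ (by simp), lintegral_mul_const' _ _ ENNReal.ofReal_ne_top]
  rfl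

/-- Setting the value ⊤ on a measurable null set gives domination everywhere. Almost everywhere
would not do, since the bound is used for every f on every trajectory. -/
theorem exists_measurable_majorant {β : Type v} [MeasurableSpace β] {μ : Measure β}
    {g : β → ℝ≥0∞} (hg : AEMeasurable g μ) :
    ∃ g' : β → ℝ≥0∞, Measurable g' ∧ g ≤ g' ∧ ∫⁻ x, g' x ∂μ = ∫⁻ x, g x ∂μ := by
  classical
  obtain ⟨s, hs, hsm, hs0⟩ := exists_measurable_superset_of_null (ae_iff.1 hg.ae_eq_mk)
  refine ⟨s.piecewise (fun _ => ⊤) (hg.mk g), measurable_const.piecewise hsm hg.measurable_mk,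
    fun x => ?_, lintegral_congr_ae ?_⟩
  · by_cases hx : x ∈ s
    · simp [hx]
    · rw [Set.piecewise_eq_of_notMem _ _ _ hx]
      by_contra hne
      exact hx (hs fun h => hne h.le)
  · have : ∀ᵐ x ∂μ, x ∉ s := measure_eq_zero_iff_ae_notMem.1 hs0
    filter_upwards [this, hg.ae_eq_mk] with x hx hgx
    rw [Set.piecewise_eq_of_notMem _ _ _ hx, hgx]

theorem ofReal_exp_integral_le_lintegral {β : Type v} [MeasurableSpace β] {μ : Measure β}
    [IsProbabilityMeasure μ] {g : β → ℝ} (hg : Measurable g) {C : ℝ} (hC : ∀ x, |g x| ≤ C) :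
    ENNReal.ofReal (Real.exp (∫ x, g x ∂μ)) ≤ ∫⁻ x, ENNReal.ofReal (Real.exp (g x)) ∂μ := by
  have hint : Integrable g μ :=
    Integrable.of_bound hg.aestronglyMeasurable C (Filter.Eventually.of_forall hC)
  have hexp : Integrable (fun x => Real.exp (g x)) μ :=
    Integrable.of_bound (Real.measurable_exp.comp hg).aestronglyMeasurable (Real.exp C)
      (Filter.Eventually.of_forall fun x => by
        rw [Real.norm_eq_abs, Real.abs_exp]
        exact Real.exp_le_exp.2 ((le_abs_self _).trans (hC x)))
  rw [← ofReal_integral_eq_lintegral_ofReal hexp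
    (Filter.Eventually.of_forall fun x => (Real.exp_pos _).le)]
  exact ENNReal.ofReal_le_ofReal (convexOn_exp.map_integral_le Real.continuous_exp.continuousOn
    isClosed_univ (by simp) hint hexp)

theorem integral_tangentKernel_eval {f : 𝒵 → ℝ} (hf : Measurable f) (z : ℕ → 𝒵) (t : Fin T) :
    ∫ s, f (s t) ∂(tangentKernel p T 0 z) = condMean p f t z := by
  have h := map_eval_tangentKernel p T 0 z t
  have cast : ∀ a b : ℕ, a = b → (p a fun s : Fin a => z s) = p b fun s : Fin b => z s := by
    rintro a _ rfl; rfl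
  rw [cast _ _ (zero_add (t : ℕ))] at h
  rw [condMean, ← h,
    integral_map (measurable_pi_apply t).aemeasurable hf.aestronglyMeasurable]

/-- One measurable K dominates all f simultaneously, so the possibly non-measurable supremum of the
centred sums is never integrated. -/
theorem exists_exponential_majorant {F : Set (𝒵 → ℝ)} (hF : F.Nonempty) {M : ℝ}
    (hFmeas : ∀ f ∈ F, Measurable f) (hFbdd : ∀ f ∈ F, ∀ z, 0 ≤ f z ∧ f z ≤ M)
    (hFsup : IsMeasurableClass T F) (q : Fin T → ℝ) {α l : ℝ} (hα : 0 ≤ α) (hl : 0 ≤ l)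
    {ν : Measure (ℕ → 𝒵)} [IsProbabilityMeasure ν]
    (hν : ∀ t < T, HasCondDistrib (fun z : ℕ → 𝒵 => z t) (fun z (s : Fin t) => z s) (p t) ν) :
    ∃ K : (ℕ → 𝒵) → ℝ≥0∞, Measurable K ∧
      (∀ f ∈ F, ∀ z, ENNReal.ofReal
        (Real.exp (l * ∑ t : Fin T, q t * (condMean p f t z - f (z t)))) ≤ K z) ∧
      ∫⁻ z, K z ∂ν ≤ expectedCoveringNumber p q α F *
        ENNReal.ofReal (Real.exp (2 * l * α + l ^ 2 * M ^ 2 * (∑ t, q t ^ 2) / 2)) := by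
  obtain ⟨H, hHm, hHle, hHint⟩ := exists_measurable_majorant
    (Finset.aemeasurable_fun_sum Finset.univ fun σ (_ : σ ∈ Finset.univ) =>
      aemeasurable_signedExpSup_selectPath p hFsup q M l σ)
  have hpair : Measurable fun u : (ℕ → 𝒵) × (Fin T → 𝒵) =>
      H fun i : Fin T => (u.1 i, u.2 i) := by
    refine hHm.comp (measurable_pi_lambda _ fun i => ?_)
    exact ((measurable_pi_apply (i : ℕ)).comp measurable_fst).prodMk
      ((measurable_pi_apply i).comp measurable_snd)
  have hKm : Measurable fun z : ℕ → 𝒵 =>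
      ∫⁻ s, H (fun i : Fin T => (z i, s i)) ∂(tangentKernel p T 0 z) :=
    Measurable.lintegral_kernel_prod_right' (κ := tangentKernel p T 0) hpair
  have h2 : (2 : ℝ≥0∞) ^ T ≠ 0 := by positivity
  have h2' : (2 : ℝ≥0∞) ^ T ≠ ⊤ := by simp
  refine ⟨fun z => (2 ^ T)⁻¹ * ∫⁻ s, H (fun i : Fin T => (z i, s i)) ∂(tangentKernel p T 0 z),
    hKm.const_mul _, fun f hf z => ?_, ?_⟩
  · have hfm := hFmeas f hf
    have hgm : Measurable fun s : Fin T → 𝒵 => l * ∑ t : Fin T, q t * (f (s t) - f (z t)) := by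
      fun_prop
    have hM : ∀ x y : 𝒵, |f x - f y| ≤ M := fun x y => by
      have hx := hFbdd f hf x
      have hy := hFbdd f hf y
      exact abs_le.2 ⟨by linarith, by linarith⟩
    have hbdd : ∀ s : Fin T → 𝒵, |l * ∑ t : Fin T, q t * (f (s t) - f (z t))|
        ≤ l * ∑ t : Fin T, |q t| * M := fun s => by
      rw [abs_mul, abs_of_nonneg hl]
      refine mul_le_mul_of_nonneg_left ((Finset.abs_sum_le_sum_abs _ _).trans
        (Finset.sum_le_sum fun t _ => ?_)) hl
      rw [abs_mul]
      exact mul_le_mul_of_nonneg_left (hM _ _) (abs_nonneg _)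
    have hfi : ∀ t : Fin T, Integrable (fun s : Fin T → 𝒵 => f (s t)) (tangentKernel p T 0 z) :=
      fun t => Integrable.of_bound (hfm.comp (measurable_pi_apply t)).aestronglyMeasurable M
        (Filter.Eventually.of_forall fun s => by
          have := hFbdd f hf (s t)
          rw [Real.norm_eq_abs, abs_of_nonneg this.1]
          exact this.2)
    have hmean : ∫ s, l * ∑ t : Fin T, q t * (f (s t) - f (z t)) ∂(tangentKernel p T 0 z)
        = l * ∑ t : Fin T, q t * (condMean p f t z - f (z t)) := by
      have hti : ∀ t : Fin T, Integrable (fun s : Fin T → 𝒵 => q t * (f (s t) - f (z t)))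
          (tangentKernel p T 0 z) := fun t => ((hfi t).sub (integrable_const _)).const_mul _
      rw [integral_const_mul, integral_finsetSum _ fun t _ => hti t]
      congr 1
      refine Finset.sum_congr rfl fun t _ => ?_
      rw [integral_const_mul, integral_sub (hfi t) (integrable_const _),
        integral_tangentKernel_eval p hfm z t]
      simp
    beta_reduce
    rw [← hmean, mul_comm, ← div_eq_mul_inv, ENNReal.le_div_iff_mul_le (Or.inl h2) (Or.inl h2')]
    -- Jensen for the tangent law, with z and f fixed; the symmetrization inequality then applies
    -- for each s.
    refine (mul_le_mul_left (ofReal_exp_integral_le_lintegral hgm hbdd) _).trans ?_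
    rw [mul_comm, ← lintegral_const_mul' _ _ h2']
    refine lintegral_mono fun s => le_trans ?_ (hHle _)
    have := exp_sum_sub_le_sum_signedExpSup hFbdd q hl hf fun i : Fin T => (z i, s i)
    beta_reduce
    rw [← ENNReal.ofReal_sum_of_nonneg fun σ _ => signedExpSup_nonneg _ _ _ _ _ _]
    refine le_trans (le_of_eq ?_) (ENNReal.ofReal_le_ofReal this)
    rw [ENNReal.ofReal_mul (by positivity), ENNReal.ofReal_pow (by norm_num)]
    simp
  -- Decoupling from the empty history: the pair-path law no longer depends on z.
  · have hdec := lintegral_tangentKernel_eq_pairPathKernel p hν T 0 (by omega)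
      (G := fun u => H u.2) (hHm.comp measurable_snd)
    have helim : ∀ z : ℕ → 𝒵, (fun i : Fin 0 => z i) = Fin.elim0 := fun z =>
      Subsingleton.elim _ _
    simp only [zero_add, helim, lintegral_const, measure_univ, mul_one] at hdec
    rw [lintegral_const_mul _ hKm, hdec, hHint]
    refine (mul_le_mul_right (lintegral_sum_signedExpSup_le p hF hFbdd hFsup q hα hl) _).trans ?_
    rw [← mul_assoc, ENNReal.inv_mul_cancel h2 h2', one_mul]

end Expectation

/-! ### Reduction of Φ - disc to the majorant, and Markov's inequality. -/

section Deviation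

variable {𝒵 : Type u} [MeasurableSpace 𝒵] {T : ℕ}

theorem condMean_congr (p : (t : ℕ) → Kernel (Fin t → 𝒵) 𝒵) (f : 𝒵 → ℝ) {t : ℕ}
    {z z' : ℕ → 𝒵} (h : ∀ s < t, z s = z' s) : condMean p f t z = condMean p f t z' := by
  have : (fun s : Fin t => z s) = fun s : Fin t => z' s := funext fun s => h s s.2
  rw [condMean, condMean, this]

theorem supDeviation_congr (p : (t : ℕ) → Kernel (Fin t → 𝒵) 𝒵) (q : Fin T → ℝ)
    (F : Set (𝒵 → ℝ)) {z z' : ℕ → 𝒵} (h : ∀ s < T, z s = z' s) :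
    supDeviation p q F z = supDeviation p q F z' := by
  unfold supDeviation
  congr 1
  funext f
  rw [condMean_congr p f.1 h]
  congr 1
  exact Finset.sum_congr rfl fun t _ => by rw [h t t.2]

theorem disc_congr (p : (t : ℕ) → Kernel (Fin t → 𝒵) 𝒵) (q : Fin T → ℝ)
    (F : Set (𝒵 → ℝ)) {z z' : ℕ → 𝒵} (h : ∀ s < T, z s = z' s) :
    disc p q F z = disc p q F z' := by
  unfold disc
  congr 1
  funext f
  rw [condMean_congr p f.1 h]
  congr 1
  exact Finset.sum_congr rfl fun t _ => by
    rw [condMean_congr p f.1 fun s hs => h s (hs.trans t.2)]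

/-- The law of a process inherits its conditional distributions. -/
theorem hasCondDistrib_map (p : (t : ℕ) → Kernel (Fin t → 𝒵) 𝒵) {Ω : Type v} [MeasurableSpace Ω] {P : Measure Ω} {W : Ω → ℕ → 𝒵}
    (hW : AEMeasurable W P) {t : ℕ}
    (h : HasCondDistrib (fun ω => W ω t) (fun ω (s : Fin t) => W ω s) (p t) P) :
    HasCondDistrib (fun z : ℕ → 𝒵 => z t) (fun z (s : Fin t) => z s) (p t) (P.map W) := by
  have hm : Measurable fun z : ℕ → 𝒵 => ((fun s : Fin t => z s), z t) :=
    (measurable_history t).prodMk (measurable_pi_apply t)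
  refine ⟨hm.aemeasurable, ?_⟩
  rw [AEMeasurable.map_map_of_aemeasurable hm.aemeasurable hW,
    AEMeasurable.map_map_of_aemeasurable (measurable_history t).aemeasurable hW]
  exact h.map_eq

variable (p : (t : ℕ) → Kernel (Fin t → 𝒵) 𝒵) [∀ t, IsMarkovKernel (p t)]

theorem abs_condMean_le {f : 𝒵 → ℝ} {M : ℝ} (hf : ∀ z, 0 ≤ f z ∧ f z ≤ M) (t : ℕ) (z : ℕ → 𝒵) :
    |condMean p f t z| ≤ M := by
  have := norm_integral_le_of_norm_le_const (μ := p t fun s : Fin t => z s) (f := f) (C := M)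
    (Filter.Eventually.of_forall fun x => by
      rw [Real.norm_eq_abs, abs_of_nonneg (hf x).1]; exact (hf x).2)
  simpa [condMean] using this

theorem bddAbove_range_disc {F : Set (𝒵 → ℝ)} {M : ℝ}
    (hFbdd : ∀ f ∈ F, ∀ z, 0 ≤ f z ∧ f z ≤ M) (q : Fin T → ℝ) (z : ℕ → 𝒵) :
    BddAbove (Set.range fun f : F =>
      condMean p f.1 T z - ∑ t : Fin T, q t * condMean p f.1 t z) := by
  refine ⟨M + ∑ t, |q t| * M, ?_⟩
  rintro _ ⟨f, rfl⟩
  have h1 := (le_abs_self _).trans (abs_condMean_le p (hFbdd f.1 f.2) T z)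
  have h2 : |∑ t : Fin T, q t * condMean p f.1 t z| ≤ ∑ t, |q t| * M :=
    (Finset.abs_sum_le_sum_abs _ _).trans (Finset.sum_le_sum fun t _ => by
      rw [abs_mul]
      exact mul_le_mul_of_nonneg_left (abs_condMean_le p (hFbdd f.1 f.2) t z) (abs_nonneg _))
  have h3 := neg_abs_le (∑ t : Fin T, q t * condMean p f.1 t z)
  change condMean p f.1 T z - ∑ t : Fin T, q t * condMean p f.1 t z ≤ _
  linarith

/-- Taking logarithms, each centred sum is at most log K / l. Adding the discrepancy bounds every
term of the supremum defining Φ, so the uniform bound passes to that supremum. -/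
theorem ofReal_exp_le_of_le_supDeviation_sub_disc {F : Set (𝒵 → ℝ)} (hF : F.Nonempty) {M : ℝ}
    (hFbdd : ∀ f ∈ F, ∀ z, 0 ≤ f z ∧ f z ≤ M) (q : Fin T → ℝ) {l ε : ℝ} (hl : 0 < l)
    {z : ℕ → 𝒵} {K : ℝ≥0∞}
    (hK : ∀ f ∈ F, ENNReal.ofReal
      (Real.exp (l * ∑ t : Fin T, q t * (condMean p f t z - f (z t)))) ≤ K)
    (hε : ε ≤ supDeviation p q F z - disc p q F z) :
    ENNReal.ofReal (Real.exp (l * ε)) ≤ K := by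
  by_cases hKtop : K = ⊤
  · simp [hKtop]
  have := hF.to_subtype
  have hexp : ∀ f ∈ F, Real.exp (l * ∑ t : Fin T, q t * (condMean p f t z - f (z t)))
      ≤ K.toReal := fun f hf => (ENNReal.ofReal_le_iff_le_toReal hKtop).1 (hK f hf)
  have hpos : 0 < K.toReal := by
    obtain ⟨f, hf⟩ := hF
    exact (Real.exp_pos _).trans_le (hexp f hf)
  have hsup : supDeviation p q F z ≤ disc p q F z + Real.log K.toReal / l := by
    refine ciSup_le fun f => ?_
    have h1 := le_ciSup (bddAbove_range_disc p hFbdd q z) f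
    have h2 := (Real.le_log_iff_exp_le hpos).2 (hexp f.1 f.2)
    rw [mul_comm, ← le_div_iff₀ hl] at h2
    simp only [mul_sub, Finset.sum_sub_distrib] at h2
    have h3 : condMean p f.1 T z - ∑ t : Fin T, q t * condMean p f.1 t z ≤ disc p q F z := h1
    linarith
  have hlog : ε ≤ Real.log K.toReal / l := by linarith
  rw [le_div_iff₀ hl, mul_comm, Real.le_log_iff_exp_le hpos] at hlog
  exact ENNReal.ofReal_le_of_le_toReal hlog

/-- The deviation event need not be measurable. It is included in the measurable event that K is at
least exp(lε), to which Markov's inequality applies. -/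
theorem measure_le_exponential_bound {Ω : Type v} [MeasurableSpace Ω] {P : Measure Ω}
    [IsProbabilityMeasure P] {Z : ℕ → Ω → 𝒵}
    (hp : ∀ t ≤ T, HasCondDistrib (Z t) (fun ω (s : Fin t) => Z s ω) (p t) P)
    {M : ℝ} {F : Set (𝒵 → ℝ)} (hF : F.Nonempty)
    (hFmeas : ∀ f ∈ F, Measurable f) (hFbdd : ∀ f ∈ F, ∀ z, 0 ≤ f z ∧ f z ≤ M)
    (hFsup : IsMeasurableClass T F) (q : Fin T → ℝ) {α ε l : ℝ} (hα : 0 ≤ α) (hl : 0 < l) :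
    P {ω | ε ≤ supDeviation p q F (fun t => Z t ω) - disc p q F (fun t => Z t ω)}
      ≤ expectedCoveringNumber p q α F * ENNReal.ofReal
        (Real.exp (-(l * (ε - 2 * α)) + l ^ 2 * M ^ 2 * (∑ t, q t ^ 2) / 2)) := by
  -- the observations after time `T` need not be measurable, so they are frozen
  let W : Ω → ℕ → 𝒵 := fun ω t => Z (min t T) ω
  have hWZ : ∀ ω, ∀ s ≤ T, Z s ω = W ω s := fun ω s hs => by simp only [W, min_eq_left hs]
  have hW : AEMeasurable W P := aemeasurable_pi_lambda _ fun t =>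
    (hp (min t T) (min_le_right _ _)).aemeasurable_snd
  have := Measure.isProbabilityMeasure_map hW
  have hν : ∀ t < T, HasCondDistrib (fun z : ℕ → 𝒵 => z t) (fun z (s : Fin t) => z s) (p t)
      (P.map W) := fun t ht => by
    refine hasCondDistrib_map p hW ?_
    have h1 : Z t = fun ω => W ω t := funext fun ω => hWZ ω t ht.le
    have h2 : (fun ω (s : Fin t) => Z s ω) = fun ω (s : Fin t) => W ω s :=
      funext fun ω => funext fun s => hWZ ω s (s.2.le.trans ht.le)
    rw [← h1, ← h2]
    exact hp t ht.le
  obtain ⟨K, hKm, hK, hKint⟩ :=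
    exists_exponential_majorant p hF hFmeas hFbdd hFsup q hα hl.le hν
  have hsub : {ω | ε ≤ supDeviation p q F (fun t => Z t ω) - disc p q F (fun t => Z t ω)}
      ⊆ W ⁻¹' {z | ENNReal.ofReal (Real.exp (l * ε)) ≤ K z} := fun ω hω => by
    have hω' : ε ≤ supDeviation p q F (fun t => Z t ω) - disc p q F (fun t => Z t ω) := hω
    have hcongr : ∀ s < T, (fun t => Z t ω) s = W ω s := fun s hs => hWZ ω s hs.le
    rw [supDeviation_congr p q F hcongr, disc_congr p q F hcongr] at hω'
    exact ofReal_exp_le_of_le_supDeviation_sub_disc p hF hFbdd q hl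
      (fun f hf => hK f hf (W ω)) hω'
  have hpos : ENNReal.ofReal (Real.exp (l * ε)) ≠ 0 := by
    simpa using Real.exp_pos (l * ε)
  calc P {ω | ε ≤ supDeviation p q F (fun t => Z t ω) - disc p q F (fun t => Z t ω)}
      ≤ P (W ⁻¹' {z | ENNReal.ofReal (Real.exp (l * ε)) ≤ K z}) := measure_mono hsub
    _ = P.map W {z | ENNReal.ofReal (Real.exp (l * ε)) ≤ K z} :=
        (Measure.map_apply_of_aemeasurable hW (measurableSet_le measurable_const hKm)).symm
    _ ≤ (∫⁻ z, K z ∂(P.map W)) / ENNReal.ofReal (Real.exp (l * ε)) :=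
        meas_ge_le_lintegral_div hKm.aemeasurable hpos ENNReal.ofReal_ne_top
    _ ≤ (expectedCoveringNumber p q α F *
          ENNReal.ofReal (Real.exp (2 * l * α + l ^ 2 * M ^ 2 * (∑ t, q t ^ 2) / 2))) /
            ENNReal.ofReal (Real.exp (l * ε)) := ENNReal.div_le_div_right hKint _
    _ = _ := by
        rw [mul_div_assoc, ← ENNReal.ofReal_div_of_pos (Real.exp_pos _), ← Real.exp_sub]
        congr 3
        ring

end Deviation

end Forecasting

/-! ### Choice of the exponential parameter. -/

theorem theorem1 {Ω 𝒵 : Type*} [MeasurableSpace Ω] [MeasurableSpace 𝒵]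
    (P : Measure Ω) [IsProbabilityMeasure P]
    (T : ℕ) (Z : ℕ → Ω → 𝒵)
    (p : (t : ℕ) → Kernel (Fin t → 𝒵) 𝒵) [∀ t, IsMarkovKernel (p t)]
    (hp : ∀ t ≤ T, HasCondDistrib (Z t) (fun ω (s : Fin t) => Z s ω) (p t) P)
    (M : ℝ) (F : Set (𝒵 → ℝ)) (hF : F.Nonempty)
    (hFmeas : ∀ f ∈ F, Measurable f) (hFbdd : ∀ f ∈ F, ∀ z, 0 ≤ f z ∧ f z ≤ M)
    (hFsup : Forecasting.IsMeasurableClass T F)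
    (q : Fin T → ℝ) (α ε : ℝ) (hα : 0 < α) (hε : 2 * α < ε) :
    P {ω | ε ≤ Forecasting.supDeviation p q F (fun t => Z t ω)
            - Forecasting.disc p q F (fun t => Z t ω)}
      ≤ Forecasting.expectedCoveringNumber p q α F
        * ENNReal.ofReal (Real.exp (-((ε - 2 * α) ^ 2 / (2 * M ^ 2 * ∑ t, q t ^ 2)))) := by
  have bound := fun l : ℝ => Forecasting.measure_le_exponential_bound p hp hF hFmeas hFbdd hFsup q
    (ε := ε) (l := l) hα.le
  have hgap : 0 < ε - 2 * α := by linarith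
  have hD : 0 ≤ M ^ 2 * ∑ t, q t ^ 2 := by positivity
  rcases hD.eq_or_lt with h0 | hpos
  -- If M = 0 or q = 0, division by zero makes the target exponent 0, and any l > 0 gives a negative
  -- one.
  · refine (bound 1 one_pos).trans ?_
    gcongr
    rw [mul_assoc 2 (M ^ 2), mul_assoc (1 ^ 2) (M ^ 2), ← h0]
    simpa using hε.le
  -- This l minimises the quadratic exponent -l(ε - 2α) + l²M²‖q‖₂²/2.
  · refine (bound ((ε - 2 * α) / (M ^ 2 * ∑ t, q t ^ 2)) (by positivity)).trans (le_of_eq ?_)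
    congr 3
    rw [mul_assoc 2 (M ^ 2), mul_assoc _ (M ^ 2)]
    field_simp
    ring
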